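/- Let $G$ be a finite group and let $s : G \to \{1,-1\}$ be a homomorphism, where $g$ is called unitary if $s(g)=1$ and anti-unitary if $s(g)=-1$. (If $s$ is non-trivial, then $G = H \cup T_0H$ is an anti-unitary group with maximal unitary subgroup $H=\ker s$; the purely unitary case $s\equiv 1$ is included.) Let $\kappa_{1}=I$ and let $\kappa_{-1}$ be entrywise complex conjugation on $V=\mathbb{C}^d$. Let $\omega : G\times G\to U(1)$ be a factor system, that is, $\omega(g_1,g_2)\,\omega(g_1g_2,g_3)=\omega(g_2,g_3)^{s(g_1)}\,\omega(g_1,g_2g_3)$, and let $M$ be a $d$-dimensional unitary projective co-representation of $G$ with factor system $\omega$: the $M(g)$ are unitary $d\times d$ matrices with $$M(g_1)\kappa_{s(g_1)}\,M(g_2)\kappa_{s(g_2)}=\omega(g_1,g_2)\,M(g_1g_2)\kappa_{s(g_1g_2)}\qquad (g_1,g_2\in G).$$ Let $Q_0$ be a random complex $d\times d$ matrix whose law is absolutely continuous with respect to Lebesgue measure on $\mathbb{C}^{d\times d}$, and put $$q_r=\sum_{g\in G}[M(g)\kappa_{s(g)}]\,Q_0\,[M(g)\kappa_{s(g)}]^{-1},\qquad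 Q_r=q_r+q_r^\dagger .$$ Then, almost surely, the eigenspaces of $Q_r$ reduce $V$ into irreducible components: $V$ is the direct sum of the eigenspaces of $Q_r$; every eigenspace is a nonzero complex subspace that is invariant under all $M(g)\kappa_{s(g)}$ and has no invariant complex subspaces other than $0$ and itself; and the orthogonal projectors onto the eigenspaces are mutually orthogonal, sum to the identity, and commute with all $M(g)\kappa_{s(g)}$. -/

import Mathlib

open MeasureTheory ComplexConjugate

noncomputable section

namespace ProjCorep

/-- The carrier space `V = ℂ^d` with its standard Hermitian inner product. -/
abbrev Carrier (d : ℕ) : Type := EuclideanSpace ℂ (Fin d)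

/-- The operator `κ_ε` on `ℂ^d`: the identity for `ε = 1`, and entrywise complex conjugation for
`ε = -1`. It is real-linear. -/
def kappa (d : ℕ) (ε : ℤˣ) : Carrier d →ₗ[ℝ] Carrier d where
  toFun v := WithLp.toLp 2 fun i => if ε = 1 then v i else conj (v i)
  map_add' v w := by
    ext i; by_cases h : ε = 1 <;> simp [h]
  map_smul' c v := by
    ext i; by_cases h : ε = 1 <;> simp [h]

/-- The linear operator of a complex matrix, regarded as a real-linear operator. -/
def matOp {d : ℕ} (A : Matrix (Fin d) (Fin d) ℂ) : Module.End ℝ (Carrier d) :=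
  (Matrix.toEuclideanLin A).restrictScalars ℝ

variable {G : Type*} [Group G]

/-- A `U(1)`-valued factor system on a group `G` whose unitary elements are those with `s g = 1`
and whose anti-unitary elements are those with `s g = -1`. (For `z` in `U(1)`, `z ^ (-1)` is the
complex conjugate of `z`.) -/
structure FactorSystem (s : G →* ℤˣ) where
  toFun : G → G → Circle
  cocycle : ∀ g₁ g₂ g₃ : G,
    toFun g₁ g₂ * toFun (g₁ * g₂) g₃
      = toFun g₂ g₃ ^ ((s g₁ : ℤˣ) : ℤ) * toFun g₁ (g₂ * g₃)

/-- A `d`-dimensional unitary projective co-representation with factor system `ω`: unitary matrices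
`M g` with `M(g₁)κ_{s(g₁)} M(g₂)κ_{s(g₂)} = ω(g₁,g₂) M(g₁g₂)κ_{s(g₁g₂)}`. -/
structure Corep (s : G →* ℤˣ) (ω : FactorSystem s) (d : ℕ) where
  M : G → Matrix (Fin d) (Fin d) ℂ
  unitary : ∀ g, M g ∈ Matrix.unitaryGroup (Fin d) ℂ
  mul : ∀ (g₁ g₂ : G) (v : Carrier d),
    (matOp (M g₁) * kappa d (s g₁)) ((matOp (M g₂) * kappa d (s g₂)) v)
      = (ω.toFun g₁ g₂ : ℂ) • (matOp (M (g₁ * g₂)) * kappa d (s (g₁ * g₂))) v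

/-- Conjugation of a matrix by `κ_ε`: the matrix of `κ_ε A κ_ε⁻¹`. -/
def kappaConj {d : ℕ} (ε : ℤˣ) (A : Matrix (Fin d) (Fin d) ℂ) : Matrix (Fin d) (Fin d) ℂ :=
  if ε = 1 then A else A.map conj

namespace Corep

variable {s : G →* ℤˣ} {ω : FactorSystem s} {d : ℕ} (ρ : Corep s ω d)

/-- The operator `M(g)κ_{s(g)}` on `V`. -/
def op (g : G) : Module.End ℝ (Carrier d) := matOp (ρ.M g) * kappa d (s g)

/-- The matrix `q_r = ∑_g [M(g)κ_{s(g)}] Q₀ [M(g)κ_{s(g)}]⁻¹`; see `matOp_avg` for the equality of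
operators. -/
def avg [Fintype G] (Q₀ : Matrix (Fin d) (Fin d) ℂ) : Matrix (Fin d) (Fin d) ℂ :=
  ∑ g, ρ.M g * kappaConj (s g) Q₀ * (ρ.M g)⁻¹

/-- The Hermitian matrix `Q_r = q_r + q_r†`. -/
def hermAvg [Fintype G] (Q₀ : Matrix (Fin d) (Fin d) ℂ) : Matrix (Fin d) (Fin d) ℂ :=
  ρ.avg Q₀ + (ρ.avg Q₀).conjTranspose

/-- The complex-linear operator on `V` given by the matrix `Q_r`. -/
def hermOp [Fintype G] (Q₀ : Matrix (Fin d) (Fin d) ℂ) : Module.End ℂ (Carrier d) :=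
  Matrix.toEuclideanLin (ρ.hermAvg Q₀)

/-- The orthogonal projector of `V` onto the eigenspace of `Q_r` with eigenvalue `μ`. -/
def eigenProj [Fintype G] (Q₀ : Matrix (Fin d) (Fin d) ℂ) (μ : (ρ.hermOp Q₀).Eigenvalues) :
    Carrier d →L[ℂ] Carrier d :=
  ((ρ.hermOp Q₀).eigenspace μ).starProjection

/-- A complex subspace of `V` is invariant if every `M(g)κ_{s(g)}` maps it into itself. -/
def Invariant (W : Submodule ℂ (Carrier d)) : Prop :=
  ∀ g : G, ∀ v ∈ W, ρ.op g v ∈ W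

/-- An irreducible component: a nonzero invariant complex subspace whose only invariant complex
subspaces are `0` and itself. -/
structure IsIrreducibleComponent (W : Submodule ℂ (Carrier d)) : Prop where
  ne_bot : W ≠ ⊥
  invariant : ρ.Invariant W
  eq_bot_or_eq : ∀ W' : Submodule ℂ (Carrier d), W' ≤ W → ρ.Invariant W' → W' = ⊥ ∨ W' = W

/-- The eigenspaces of `Q_r` provide projectors reducing `V` into irreducible components: every
eigenspace is an irreducible component, `V` is the direct sum of the eigenspaces, and the orthogonal
projectors onto them are mutually orthogonal, sum to the identity and commute with every
`M(g)κ_{s(g)}`. -/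
structure EigenspacesReduce [Fintype G] (Q₀ : Matrix (Fin d) (Fin d) ℂ) : Prop where
  irreducible : ∀ μ : (ρ.hermOp Q₀).Eigenvalues,
    ρ.IsIrreducibleComponent ((ρ.hermOp Q₀).eigenspace μ)
  isInternal : DirectSum.IsInternal
    (fun μ : (ρ.hermOp Q₀).Eigenvalues => (ρ.hermOp Q₀).eigenspace μ)
  orthogonal : ∀ μ ν : (ρ.hermOp Q₀).Eigenvalues, μ ≠ ν →
    ρ.eigenProj Q₀ μ ∘L ρ.eigenProj Q₀ ν = 0
  sum_eq_id : ∑ μ : (ρ.hermOp Q₀).Eigenvalues, ρ.eigenProj Q₀ μ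
    = ContinuousLinearMap.id ℂ (Carrier d)
  commute : ∀ (μ : (ρ.hermOp Q₀).Eigenvalues) (g : G) (v : Carrier d),
    ρ.eigenProj Q₀ μ (ρ.op g v) = ρ.op g (ρ.eigenProj Q₀ μ v)

end Corep

theorem matOp_mul {d : ℕ} (A B : Matrix (Fin d) (Fin d) ℂ) :
    matOp (A * B) = matOp A * matOp B := by
  ext v i
  simp [matOp, Matrix.toLpLin_apply, Matrix.mulVec_mulVec]

theorem matOp_one {d : ℕ} : matOp (1 : Matrix (Fin d) (Fin d) ℂ) = 1 := by
  ext v i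
  simp [matOp]

theorem kappa_mul_self (d : ℕ) (ε : ℤˣ) : (kappa d ε * kappa d ε : Module.End ℝ _) = 1 := by
  ext v i
  by_cases h : ε = 1 <;> simp [kappa, h]

theorem kappa_mul_matOp {d : ℕ} (ε : ℤˣ) (A : Matrix (Fin d) (Fin d) ℂ) :
    kappa d ε * matOp A = matOp (kappaConj ε A) * kappa d ε := by
  ext v i
  by_cases h : ε = 1 <;>
    simp [kappa, matOp, kappaConj, h, Matrix.toLpLin_apply, Matrix.mulVec, dotProduct]

theorem Corep.mul_inv {s : G →* ℤˣ} {ω : FactorSystem s} {d : ℕ} (ρ : Corep s ω d) (g : G) :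
    ρ.M g * (ρ.M g)⁻¹ = 1 := by
  have h := Matrix.mem_unitaryGroup_iff.1 (ρ.unitary g)
  rw [Matrix.inv_eq_right_inv h, h]

theorem Corep.inv_mul {s : G →* ℤˣ} {ω : FactorSystem s} {d : ℕ} (ρ : Corep s ω d) (g : G) :
    (ρ.M g)⁻¹ * ρ.M g = 1 :=
  mul_eq_one_comm.1 (ρ.mul_inv g)

/-- `M(g)κ_{s(g)}` as an invertible operator. -/
def Corep.opUnit {s : G →* ℤˣ} {ω : FactorSystem s} {d : ℕ} (ρ : Corep s ω d) (g : G) :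
    (Module.End ℝ (Carrier d))ˣ where
  val := ρ.op g
  inv := kappa d (s g) * matOp (ρ.M g)⁻¹
  val_inv := by
    rw [Corep.op, mul_assoc, ← mul_assoc (kappa d (s g)) (kappa d (s g)), kappa_mul_self, one_mul,
      ← matOp_mul, ρ.mul_inv, matOp_one]
  inv_val := by
    rw [Corep.op, mul_assoc, ← mul_assoc (matOp _) (matOp _), ← matOp_mul, ρ.inv_mul, matOp_one,
      one_mul, kappa_mul_self]

/-- The matrix `q_r` represents the operator `∑_g [M(g)κ_{s(g)}] Q₀ [M(g)κ_{s(g)}]⁻¹`. -/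
theorem Corep.matOp_avg [Fintype G] {s : G →* ℤˣ} {ω : FactorSystem s} {d : ℕ}
    (ρ : Corep s ω d) (Q₀ : Matrix (Fin d) (Fin d) ℂ) :
    matOp (ρ.avg Q₀)
      = ∑ g, (ρ.opUnit g : Module.End ℝ (Carrier d)) * matOp Q₀ *
          ((ρ.opUnit g)⁻¹ : (Module.End ℝ (Carrier d))ˣ) := by
  have hsum : matOp (ρ.avg Q₀)
      = ∑ g, matOp (ρ.M g * kappaConj (s g) Q₀ * (ρ.M g)⁻¹) := by
    ext v i
    simp [matOp, Corep.avg, LinearMap.sum_apply]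
  rw [hsum]
  refine Finset.sum_congr rfl fun g _ => ?_
  change _ = (matOp (ρ.M g) * kappa d (s g)) * matOp Q₀ * (kappa d (s g) * matOp (ρ.M g)⁻¹)
  rw [mul_assoc (matOp (ρ.M g)), kappa_mul_matOp, matOp_mul, matOp_mul]
  simp only [mul_assoc]
  rw [← mul_assoc (kappa d (s g)) (kappa d (s g)), kappa_mul_self, one_mul]

end ProjCorep

end

/-!
The number of distinct eigenvalues of the Hermitian matrix `Q_r` is the degree of its minimal
polynomial. That degree is at least `N` iff `1, Q_r, …, Q_r ^ (N - 1)` are linearly independent,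
i.e. iff some determinant that is polynomial in `Q₀` does not vanish; hence it takes its largest
value for almost every `Q₀`.

For such a `Q₀` the eigenspaces are irreducible. The projector `p` onto an invariant subspace `W`
commutes with the co-representation, so it is itself an average `R_r`; if `0 ≠ W` were a proper
subspace of an eigenspace of `Q_r`, then `Q_r + ε p`, the average of `Q₀ + ε R`, would have one
more eigenvalue than `Q_r`.
-/

theorem linearIndependent_iff_exists_det_dual_ne_zero {K ι V : Type*} [Field K] [Fintype ι]
    [DecidableEq ι] [AddCommGroup V] [Module K V] {v : ι → V} :
    LinearIndependent K v ↔
      ∃ φ : ι → Module.Dual K V, (Matrix.of fun i j => φ i (v j)).det ≠ 0 := by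
  constructor
  · intro hv
    obtain ⟨g, hg⟩ := (Fintype.linearCombination K v).exists_leftInverse_of_injective
      (LinearMap.ker_eq_bot.2 (linearIndependent_iff_injective_fintypeLinearCombination.1 hv))
    refine ⟨fun i => LinearMap.proj i ∘ₗ g, ?_⟩
    have hdual : (Matrix.of fun i j => (LinearMap.proj i ∘ₗ g) (v j)) = 1 := by
      ext i j
      have hgv : g (v j) = Pi.single j 1 := by
        simpa using LinearMap.congr_fun hg (Pi.single j 1)
      simp [hgv, Matrix.one_apply, Pi.single_apply]
    rw [hdual, Matrix.det_one]
    exact one_ne_zero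
  · rintro ⟨φ, hφ⟩
    exact .of_comp (LinearMap.pi φ) (Matrix.linearIndependent_cols_of_det_ne_zero hφ)

section MinpolyDegree

variable {K S : Type*} [Field K] [Ring S] [Algebra K S]

theorem le_natDegree_minpoly_iff_linearIndependent_pow {x : S} (hx : IsIntegral K x) {N : ℕ} :
    N ≤ (minpoly K x).natDegree ↔ LinearIndependent K fun i : Fin N => x ^ (i : ℕ) := by
  refine ⟨fun h => (linearIndependent_pow x).comp (Fin.castLE h) (Fin.castLE_injective h),
    fun hli => ?_⟩
  by_contra! hdeg
  have hrel : ∑ i : Fin N, (minpoly K x).coeff i • x ^ (i : ℕ) = 0 := by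
    rw [Fin.sum_univ_eq_sum_range (fun i => (minpoly K x).coeff i • x ^ i),
      ← Polynomial.aeval_eq_sum_range' hdeg, minpoly.aeval]
  have hlead := Fintype.linearIndependent_iff.1 hli _ hrel ⟨_, hdeg⟩
  exact one_ne_zero ((minpoly.monic hx).coeff_natDegree.symm.trans hlead)

theorem natDegree_minpoly_smul {c : K} (hc : c ≠ 0) {x : S} (hx : IsIntegral K x) :
    (minpoly K (c • x)).natDegree = (minpoly K x).natDegree := by
  refine eq_of_forall_le_iff fun N => ?_
  have hpow : (fun i : Fin N => (c • x) ^ (i : ℕ)) =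
      (fun i : Fin N => Units.mk0 c hc ^ (i : ℕ)) • fun i : Fin N => x ^ (i : ℕ) := by
    ext i
    simp [smul_pow, Units.smul_def]
  rw [le_natDegree_minpoly_iff_linearIndependent_pow (hx.smul c), hpow,
    LinearIndependent.units_smul_iff, le_natDegree_minpoly_iff_linearIndependent_pow hx]

open Polynomial

theorem exists_polynomial_eval_eq_dual_eval (φ : Module.Dual K S) (q : S[X]) :
    ∃ p : K[X], ∀ t, p.eval t = φ (q.eval (algebraMap K S t)) := by
  refine ⟨∑ n ∈ q.support, monomial n (φ (q.coeff n)), fun t => ?_⟩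
  rw [eval_finsetSum, eval_eq_sum, sum_def, map_sum]
  refine Finset.sum_congr rfl fun n _ => ?_
  rw [eval_monomial, ← map_pow, ← Algebra.commutes, ← Algebra.smul_def, map_smul, smul_eq_mul,
    mul_comm]

theorem exists_polynomial_eval_eq_dual_smul_add_pow (φ : Module.Dual K S) (a b : S) (n : ℕ) :
    ∃ p : K[X], ∀ t, p.eval t = φ ((t • a + b) ^ n) := by
  obtain ⟨p, hp⟩ := exists_polynomial_eval_eq_dual_eval φ ((C a * X + C b) ^ n)
  refine ⟨p, fun t => (hp t).trans (congrArg φ ?_)⟩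
  let evalAt := eval₂RingHom' (RingHom.id S) (algebraMap K S t) fun s => (Algebra.commutes t s).symm
  calc ((C a * X + C b) ^ n).eval (algebraMap K S t)
      = evalAt (C a * X + C b) ^ n := map_pow evalAt _ n
    _ = (t • a + b) ^ n := by
      simp [evalAt, eval₂RingHom', Algebra.smul_def, Algebra.commutes]

variable [Algebra.IsIntegral K S]

theorem finite_setOfPred_natDegree_minpoly_smul_add_lt (a b : S) :
    {t : K | (minpoly K (t • a + b)).natDegree < (minpoly K b).natDegree}.Finite := by
  have hint (x : S) : IsIntegral K x := Algebra.IsIntegral.isIntegral x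
  set N := (minpoly K b).natDegree
  obtain ⟨φ, hφ⟩ := linearIndependent_iff_exists_det_dual_ne_zero.1
    ((le_natDegree_minpoly_iff_linearIndependent_pow (hint b)).1 le_rfl)
  choose p hp using fun i j : Fin N => exists_polynomial_eval_eq_dual_smul_add_pow (φ i) a b j
  have heval (t : K) : (Matrix.of p).det.eval t =
      (Matrix.of fun i j : Fin N => φ i ((t • a + b) ^ (j : ℕ))).det := by
    rw [← coe_evalRingHom, RingHom.map_det]
    exact congrArg Matrix.det (Matrix.ext fun i j => hp i j t)
  -- At `t = 0` this polynomial is the determinant that `φ` makes nonzero.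
  have hdet : (Matrix.of p).det ≠ 0 := fun h => hφ (by simpa [h] using (heval 0).symm)
  refine (finite_setOfPred_isRoot hdet).subset fun t ht => ?_
  by_contra hroot
  refine ht.not_ge ((le_natDegree_minpoly_iff_linearIndependent_pow (hint _)).2 ?_)
  exact linearIndependent_iff_exists_det_dual_ne_zero.2 ⟨φ, fun h => hroot ((heval t).trans h)⟩

theorem finite_setOfPred_natDegree_minpoly_add_smul_lt (a b : S) :
    {t : K | (minpoly K (a + t • b)).natDegree < (minpoly K b).natDegree}.Finite := by
  refine (((finite_setOfPred_natDegree_minpoly_smul_add_lt a b).image (·⁻¹)).insert 0).subset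
    fun t ht => or_iff_not_imp_left.2 fun ht0 => ⟨t⁻¹, ?_, inv_inv t⟩
  have hscale : a + t • b = t • (t⁻¹ • a + b) := by
    rw [smul_add, smul_inv_smul₀ ht0]
  rwa [Set.mem_ofPred_eq, hscale,
    natDegree_minpoly_smul ht0 (Algebra.IsIntegral.isIntegral _)] at ht

end MinpolyDegree

theorem isOpen_setOfPred_le_natDegree_minpoly {𝕜 S : Type*} [NontriviallyNormedField 𝕜]
    [CompleteSpace 𝕜] [Ring S] [TopologicalSpace S] [IsTopologicalRing S] [T2Space S]
    [Algebra 𝕜 S] [ContinuousSMul 𝕜 S] [FiniteDimensional 𝕜 S] (N : ℕ) :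
    IsOpen {x : S | N ≤ (minpoly 𝕜 x).natDegree} := by
  have hopen (φ : Fin N → Module.Dual 𝕜 S) :
      IsOpen {x : S | (Matrix.of fun i j : Fin N => φ i (x ^ (j : ℕ))).det ≠ 0} :=
    isOpen_ne.preimage <| Continuous.matrix_det <| continuous_matrix fun i j =>
      (φ i).continuous_of_finiteDimensional.comp (continuous_pow j)
  convert isOpen_iUnion hopen using 1
  ext x
  simp only [Set.mem_ofPred_eq, Set.mem_iUnion,
    le_natDegree_minpoly_iff_linearIndependent_pow (Algebra.IsIntegral.isIntegral x),
    linearIndependent_iff_exists_det_dual_ne_zero]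

theorem ae_forall_natDegree_minpoly_le {𝕜 E S : Type*} [RCLike 𝕜]
    [NormedAddCommGroup E] [NormedSpace ℝ E] [FiniteDimensional ℝ E] [MeasurableSpace E]
    [BorelSpace E] [Ring S] [TopologicalSpace S] [IsTopologicalRing S] [T2Space S]
    [Algebra 𝕜 S] [ContinuousSMul 𝕜 S] [FiniteDimensional 𝕜 S] [Module ℝ S] [IsScalarTower ℝ 𝕜 S]
    (L : E →L[ℝ] S) (μ : Measure E) [μ.IsAddHaarMeasure] :
    ∀ᵐ x ∂μ, ∀ y, (minpoly 𝕜 (L y)).natDegree ≤ (minpoly 𝕜 (L x)).natDegree := by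
  obtain ⟨b, hb⟩ : ∃ b, ∀ y, (minpoly 𝕜 (L y)).natDegree ≤ (minpoly 𝕜 (L b)).natDegree := by
    have hbdd : BddAbove (Set.range fun x => (minpoly 𝕜 (L x)).natDegree) :=
      ⟨Module.finrank 𝕜 S, Set.forall_mem_range.2 fun x => minpoly.natDegree_le (L x)⟩
    obtain ⟨b, hb⟩ := Nat.sSup_mem (Set.range_nonempty _) hbdd
    exact ⟨b, fun y => (le_csSup hbdd ⟨y, rfl⟩).trans_eq hb.symm⟩
  suffices hmax : ∀ᵐ x ∂μ,
      x ∈ {x | (minpoly 𝕜 (L b)).natDegree ≤ (minpoly 𝕜 (L x)).natDegree} by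
    filter_upwards [hmax] with x hx y using (hb y).trans hx
  refine ae_mem_of_ae_add_linearMap_mem (LinearMap.toSpanSingleton ℝ E b) volume μ
    ((isOpen_setOfPred_le_natDegree_minpoly _).preimage L.continuous).measurableSet fun x => ?_
  have hbad := (finite_setOfPred_natDegree_minpoly_add_smul_lt (K := 𝕜) (L x) (L b)).preimage
    (RCLike.ofReal_injective (K := 𝕜)).injOn
  filter_upwards [hbad.countable.ae_notMem volume] with t ht
  rw [Set.mem_preimage, Set.mem_ofPred_eq, not_lt, ← RCLike.real_smul_eq_coe_smul] at ht
  rwa [LinearMap.toSpanSingleton_apply, map_add, map_smul]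


theorem natDegree_minpoly_eq_ncard_eigenvalues {K V : Type*} [Field K] [IsAlgClosed K]
    [AddCommGroup V] [Module K V] [FiniteDimensional K V] {f : Module.End K V}
    (hf : f.IsSemisimple) : (minpoly K f).natDegree = {μ | f.HasEigenvalue μ}.ncard := by
  classical
  have hroots : (minpoly K f).rootSet K = {μ | f.HasEigenvalue μ} := by
    ext μ
    rw [Polynomial.mem_rootSet_of_ne (minpoly.ne_zero (Algebra.IsIntegral.isIntegral f)),
      Polynomial.coe_aeval_eq_eval, Set.mem_ofPred_eq, Module.End.hasEigenvalue_iff_isRoot]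
    rfl
  rw [← hroots, Set.ncard_eq_toFinset_card', Set.toFinset_card]
  exact .symm <| Polynomial.card_rootSet_eq_natDegree
    (PerfectField.separable_iff_squarefree.2 hf.minpoly_squarefree) (IsAlgClosed.splits _)

section Splitting

variable {𝕜 E : Type*} [RCLike 𝕜] [NormedAddCommGroup E] [InnerProductSpace 𝕜 E]

theorem exists_ne_zero_mem_orthogonal_of_lt {W U : Submodule 𝕜 E} [W.HasOrthogonalProjection]
    (hWU : W < U) : ∃ v ∈ U, v ≠ 0 ∧ v ∈ Wᗮ := by
  obtain ⟨u, hu, huW⟩ := SetLike.exists_of_lt hWU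
  refine ⟨u - W.starProjection u, sub_mem hu (hWU.le (Submodule.coe_mem _)), fun h => huW ?_,
    W.sub_starProjection_mem_orthogonal u⟩
  exact W.starProjection_eq_self_iff.1 (sub_eq_zero.1 h).symm

variable {T : E →ₗ[𝕜] E} {W : Submodule 𝕜 E} {μ : 𝕜}

theorem exists_hasEigenvector_mem_orthogonal (hT : T.IsSymmetric) [W.HasOrthogonalProjection]
    (hW : W < Module.End.eigenspace T μ) {ν : 𝕜} (hν : Module.End.HasEigenvalue T ν) :
    ∃ v ∈ Wᗮ, Module.End.HasEigenvector T ν v := by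
  rcases eq_or_ne ν μ with rfl | hνμ
  · obtain ⟨v, hv, hv0, hvW⟩ := exists_ne_zero_mem_orthogonal_of_lt hW
    exact ⟨v, hvW, hv, hv0⟩
  · obtain ⟨v, hv⟩ := hν.exists_hasEigenvector
    exact ⟨v, fun w hw => hT.orthogonalFamily_eigenspaces hνμ.symm ⟨w, hW.le hw⟩ ⟨v, hv.1⟩, hv⟩

theorem insert_eigenvalues_subset_eigenvalues_add_smul_starProjection (hT : T.IsSymmetric)
    [W.HasOrthogonalProjection] (hW₀ : W ≠ ⊥) (hW : W < Module.End.eigenspace T μ) (c : 𝕜) :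
    insert (μ + c) {ν | Module.End.HasEigenvalue T ν} ⊆
      {ν | Module.End.HasEigenvalue (T + c • W.starProjection.toLinearMap) ν} := by
  rintro ν (rfl | hν)
  · obtain ⟨w, hw, hw₀⟩ := W.ne_bot_iff.1 hW₀
    refine Module.End.hasEigenvalue_of_hasEigenvector ⟨Module.End.mem_eigenspace_iff.2 ?_, hw₀⟩
    simp [Module.End.mem_eigenspace_iff.1 (hW.le hw), W.starProjection_eq_self_iff.2 hw, add_smul]
  · obtain ⟨v, hvW, hv⟩ := exists_hasEigenvector_mem_orthogonal hT hW hν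
    refine Module.End.hasEigenvalue_of_hasEigenvector ⟨Module.End.mem_eigenspace_iff.2 ?_, hv.2⟩
    simp [hv.apply_eq_smul, W.starProjection_apply_eq_zero_iff.2 hvW]

end Splitting

theorem natDegree_minpoly_eq_ncard_eigenvalues_of_isSymmetric {E : Type*} [NormedAddCommGroup E]
    [InnerProductSpace ℂ E] [FiniteDimensional ℂ E] {T : E →ₗ[ℂ] E} (hT : T.IsSymmetric) :
    (minpoly ℂ T).natDegree = {ν | Module.End.HasEigenvalue T ν}.ncard :=
  natDegree_minpoly_eq_ncard_eigenvalues <|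
    Module.End.isFinitelySemisimple_iff_isSemisimple.1 hT.isFinitelySemisimple

theorem exists_natDegree_minpoly_lt_add_smul_starProjection {E : Type*} [NormedAddCommGroup E]
    [InnerProductSpace ℂ E] [FiniteDimensional ℂ E] {T : E →ₗ[ℂ] E} (hT : T.IsSymmetric)
    {W : Submodule ℂ E} {μ : ℂ} (hW₀ : W ≠ ⊥) (hW : W < Module.End.eigenspace T μ) :
    ∃ ε : ℝ, (minpoly ℂ T).natDegree <
      (minpoly ℂ (T + (ε : ℂ) • W.starProjection.toLinearMap)).natDegree := by
  have hfin : {ν | Module.End.HasEigenvalue T ν}.Finite := Module.End.finite_hasEigenvalue T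
  have hinj : Function.Injective fun ε : ℝ => μ + ε :=
    (add_right_injective μ).comp Complex.ofReal_injective
  obtain ⟨ε, hε : μ + ε ∉ {ν | Module.End.HasEigenvalue T ν}⟩ :=
    (hfin.preimage hinj.injOn).exists_notMem
  have hT' : (T + (ε : ℂ) • W.starProjection.toLinearMap).IsSymmetric :=
    hT.add (W.starProjection_isSymmetric.smul (Complex.conj_ofReal ε))
  refine ⟨ε, ?_⟩
  rw [natDegree_minpoly_eq_ncard_eigenvalues_of_isSymmetric hT,
    natDegree_minpoly_eq_ncard_eigenvalues_of_isSymmetric hT', ← Nat.add_one_le_iff,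
    ← Set.ncard_insert_of_notMem hε hfin]
  exact Set.ncard_le_ncard
    (insert_eigenvalues_subset_eigenvalues_add_smul_starProjection hT hW₀ hW ε)
    (Module.End.finite_hasEigenvalue _)

namespace ProjCorep

variable {G : Type*} [Group G] {s : G →* ℤˣ} {ω : FactorSystem s} {d : ℕ}

theorem kappaConj_add (ε : ℤˣ) (A B : Matrix (Fin d) (Fin d) ℂ) :
    kappaConj ε (A + B) = kappaConj ε A + kappaConj ε B := by
  unfold kappaConj
  split_ifs
  · rfl
  · ext; simp

theorem kappaConj_real_smul (ε : ℤˣ) (c : ℝ) (A : Matrix (Fin d) (Fin d) ℂ) :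
    kappaConj ε (c • A) = c • kappaConj ε A := by
  unfold kappaConj
  split_ifs
  · rfl
  · ext; simp

theorem kappa_smul (ε : ℤˣ) (c : ℂ) (v : Carrier d) :
    kappa d ε (c • v) = (if ε = 1 then c else conj c) • kappa d ε v := by
  ext i
  by_cases hε : ε = 1 <;> simp [kappa, hε]

theorem inner_kappa (ε : ℤˣ) (v w : Carrier d) :
    inner ℂ (kappa d ε v) (kappa d ε w) =
      if ε = 1 then inner ℂ v w else conj (inner ℂ v w) := by
  by_cases hε : ε = 1 <;> simp [kappa, hε, PiLp.inner_apply]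

theorem matOp_injective :
    Function.Injective (matOp : Matrix (Fin d) (Fin d) ℂ → Module.End ℝ (Carrier d)) :=
  (LinearMap.restrictScalars_injective ℝ).comp Matrix.toEuclideanLin.injective

theorem matOp_add (A B : Matrix (Fin d) (Fin d) ℂ) : matOp (A + B) = matOp A + matOp B := by
  ext1 v
  simp [matOp]

theorem matOp_real_smul (c : ℝ) (A : Matrix (Fin d) (Fin d) ℂ) :
    matOp (c • A) = c • matOp A := by
  ext v i
  simp [matOp, Matrix.toLpLin_apply, Matrix.smul_mulVec]

theorem matOp_apply_smul (A : Matrix (Fin d) (Fin d) ℂ) (c : ℂ) (v : Carrier d) :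
    matOp A (c • v) = c • matOp A v :=
  (Matrix.toEuclideanLin A).map_smul c v

theorem inner_matOp_conjTranspose (A : Matrix (Fin d) (Fin d) ℂ) (v w : Carrier d) :
    inner ℂ (matOp A.conjTranspose v) w = inner ℂ v (matOp A w) := by
  change inner ℂ (Matrix.toEuclideanLin A.conjTranspose v) w = _
  rw [Matrix.toEuclideanLin_conjTranspose_eq_adjoint, LinearMap.adjoint_inner_left]
  rfl

theorem inner_matOp_of_mem_unitaryGroup {A : Matrix (Fin d) (Fin d) ℂ}
    (hA : A ∈ Matrix.unitaryGroup (Fin d) ℂ) (v w : Carrier d) :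
    inner ℂ (matOp A v) (matOp A w) = inner ℂ v w := by
  rw [← inner_matOp_conjTranspose, ← Module.End.mul_apply, ← matOp_mul,
    ← Matrix.star_eq_conjTranspose, Matrix.mem_unitaryGroup_iff'.1 hA, matOp_one,
    Module.End.one_apply]

namespace Corep

variable (ρ : Corep s ω d)

theorem op_bijective (g : G) : Function.Bijective (ρ.op g) :=
  (Module.End.isUnit_iff _).1 (ρ.opUnit g).isUnit

theorem op_smul (g : G) (c : ℂ) (v : Carrier d) :
    ρ.op g (c • v) = (if s g = 1 then c else conj c) • ρ.op g v := by
  rw [op, Module.End.mul_apply, kappa_smul, matOp_apply_smul, Module.End.mul_apply]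

theorem smul_op (g : G) (c : ℂ) (v : Carrier d) :
    c • ρ.op g v = ρ.op g ((if s g = 1 then c else conj c) • v) := by
  rw [op_smul]
  split_ifs <;> simp

theorem op_op (g h : G) (v : Carrier d) :
    ρ.op g (ρ.op h v) = (ω.toFun g h : ℂ) • ρ.op (g * h) v :=
  ρ.mul g h v

theorem inner_op (g : G) (v w : Carrier d) :
    inner ℂ (ρ.op g v) (ρ.op g w) = if s g = 1 then inner ℂ v w else conj (inner ℂ v w) := by
  rw [op, Module.End.mul_apply, Module.End.mul_apply,
    inner_matOp_of_mem_unitaryGroup (ρ.unitary g), inner_kappa]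

/-- The matrix `A` commutes with every `M(g)κ_{s(g)}`, as operators on the underlying real space
(antiunitary elements are not complex-linear). -/
def Commutes (A : Matrix (Fin d) (Fin d) ℂ) : Prop :=
  ∀ g, Commute (matOp A) (ρ.op g)

variable {ρ}

theorem Commutes.matOp_op {A : Matrix (Fin d) (Fin d) ℂ} (hA : ρ.Commutes A) (g : G)
    (v : Carrier d) : matOp A (ρ.op g v) = ρ.op g (matOp A v) :=
  LinearMap.congr_fun (hA g).eq v

theorem Commutes.add {A B : Matrix (Fin d) (Fin d) ℂ} (hA : ρ.Commutes A) (hB : ρ.Commutes B) :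
    ρ.Commutes (A + B) := fun g => by
  rw [matOp_add]
  exact (hA g).add_left (hB g)

theorem Commutes.conjTranspose {A : Matrix (Fin d) (Fin d) ℂ} (hA : ρ.Commutes A) :
    ρ.Commutes A.conjTranspose := fun g => by
  refine LinearMap.ext fun v => ext_inner_right ℂ fun w => ?_
  obtain ⟨u, rfl⟩ := (ρ.op_bijective g).2 w
  calc inner ℂ (matOp A.conjTranspose (ρ.op g v)) (ρ.op g u)
      = inner ℂ (ρ.op g v) (ρ.op g (matOp A u)) := by
        rw [inner_matOp_conjTranspose, hA.matOp_op]
    _ = inner ℂ (ρ.op g (matOp A.conjTranspose v)) (ρ.op g u) := by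
        rw [inner_op, inner_op, inner_matOp_conjTranspose]

theorem Commutes.invariant_eigenspace {A : Matrix (Fin d) (Fin d) ℂ} (hA : ρ.Commutes A) {μ : ℂ}
    (hμ : conj μ = μ) : ρ.Invariant (Module.End.eigenspace (Matrix.toEuclideanLin A) μ) := by
  intro g v hv
  rw [Module.End.mem_eigenspace_iff] at hv ⊢
  calc Matrix.toEuclideanLin A (ρ.op g v) = ρ.op g (Matrix.toEuclideanLin A v) := hA.matOp_op g v
    _ = μ • ρ.op g v := by rw [hv, op_smul, hμ, ite_self]

theorem Invariant.exists_op_eq {W : Submodule ℂ (Carrier d)} (hW : ρ.Invariant W) (g : G)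
    {w : Carrier d} (hw : w ∈ W) : ∃ v ∈ W, ρ.op g v = w := by
  let f : W.restrictScalars ℝ →ₗ[ℝ] W.restrictScalars ℝ := (ρ.op g).restrict (hW g)
  have hf : Function.Injective f := fun x y h =>
    Subtype.ext ((ρ.op_bijective g).1 (congrArg Subtype.val h))
  obtain ⟨v, hv⟩ := LinearMap.injective_iff_surjective.1 hf ⟨w, hw⟩
  exact ⟨v, v.2, congrArg Subtype.val hv⟩

theorem Invariant.orthogonal {W : Submodule ℂ (Carrier d)} (hW : ρ.Invariant W) :
    ρ.Invariant Wᗮ := by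
  intro g v hv w hw
  obtain ⟨u, hu, rfl⟩ := hW.exists_op_eq g hw
  rw [inner_op, hv u hu, map_zero, ite_self]

theorem Invariant.starProjection_op {W : Submodule ℂ (Carrier d)} (hW : ρ.Invariant W) (g : G)
    (v : Carrier d) : W.starProjection (ρ.op g v) = ρ.op g (W.starProjection v) := by
  refine Submodule.eq_starProjection_of_mem_orthogonal (hW g _ (Submodule.coe_mem _)) ?_
  rw [← map_sub]
  exact hW.orthogonal g _ (Submodule.sub_starProjection_mem_orthogonal v)

theorem Invariant.commutes_starProjection {W : Submodule ℂ (Carrier d)} (hW : ρ.Invariant W) :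
    ρ.Commutes (Matrix.toEuclideanLin.symm W.starProjection.toLinearMap) := fun g => by
  ext1 v
  simpa [matOp] using hW.starProjection_op g v

variable (ρ)

theorem conj_opUnit_apply_op (g : G) (Q : Matrix (Fin d) (Fin d) ℂ) (v : Carrier d) :
    ((ρ.opUnit g).val * matOp Q * (ρ.opUnit g)⁻¹.val) (ρ.op g v) = ρ.op g (matOp Q v) := by
  have hinv : (ρ.opUnit g)⁻¹.val (ρ.op g v) = v :=
    LinearMap.congr_fun (ρ.opUnit g).inv_mul v
  rw [Module.End.mul_apply, hinv]
  rfl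

theorem op_mul_conj_opUnit (h g : G) (Q : Matrix (Fin d) (Fin d) ℂ) :
    ρ.op h * ((ρ.opUnit g).val * matOp Q * (ρ.opUnit g)⁻¹.val) =
      (ρ.opUnit (h * g)).val * matOp Q * (ρ.opUnit (h * g))⁻¹.val * ρ.op h := by
  ext1 v
  obtain ⟨u, rfl⟩ := (ρ.op_bijective g).2 v
  rw [Module.End.mul_apply, conj_opUnit_apply_op, Module.End.mul_apply _ (ρ.op h), op_op, op_op,
    smul_op, smul_op, conj_opUnit_apply_op, matOp_apply_smul]

section Average

variable [Fintype G]

theorem commutes_avg (Q : Matrix (Fin d) (Fin d) ℂ) : ρ.Commutes (ρ.avg Q) := fun h => by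
  rw [Commute, SemiconjBy, matOp_avg, Finset.mul_sum, Finset.sum_mul,
    ← Equiv.sum_comp (Equiv.mulLeft h)]
  exact Finset.sum_congr rfl fun g _ => (ρ.op_mul_conj_opUnit h g Q).symm

theorem commutes_hermAvg (Q : Matrix (Fin d) (Fin d) ℂ) : ρ.Commutes (ρ.hermAvg Q) :=
  (ρ.commutes_avg Q).add (ρ.commutes_avg Q).conjTranspose

theorem isSymmetric_hermOp (Q : Matrix (Fin d) (Fin d) ℂ) : (ρ.hermOp Q).IsSymmetric :=
  Matrix.isSymmetric_toEuclideanLin_iff.2 (Matrix.isHermitian_add_transpose_self _)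

theorem invariant_eigenspace_hermOp (Q : Matrix (Fin d) (Fin d) ℂ)
    (μ : (ρ.hermOp Q).Eigenvalues) : ρ.Invariant ((ρ.hermOp Q).eigenspace μ) :=
  (ρ.commutes_hermAvg Q).invariant_eigenspace
    ((ρ.isSymmetric_hermOp Q).conj_eigenvalue_eq_self μ.2)

theorem isLinearMap_avg : IsLinearMap ℝ ρ.avg where
  map_add Q R := by
    simp only [avg, kappaConj_add, mul_add, add_mul, Finset.sum_add_distrib]
  map_smul c Q := by
    simp only [avg, kappaConj_real_smul, mul_smul_comm, smul_mul_assoc, Finset.smul_sum]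

theorem isLinearMap_hermAvg : IsLinearMap ℝ ρ.hermAvg where
  map_add Q R := by
    rw [hermAvg, ρ.isLinearMap_avg.map_add, Matrix.conjTranspose_add, add_add_add_comm]
    rfl
  map_smul c Q := by
    rw [hermAvg, ρ.isLinearMap_avg.map_smul, Matrix.conjTranspose_smul, star_trivial, ← smul_add]
    rfl

variable {ρ}

theorem Commutes.avg_eq {A : Matrix (Fin d) (Fin d) ℂ} (hA : ρ.Commutes A) :
    ρ.avg A = (Fintype.card G : ℝ) • A := by
  have hconj (g : G) : (ρ.opUnit g).val * matOp A * (ρ.opUnit g)⁻¹.val = matOp A :=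
    (Units.mul_inv_eq_iff_eq_mul _).2 (hA g).eq.symm
  refine matOp_injective ?_
  rw [matOp_avg, matOp_real_smul, Finset.sum_congr rfl fun g _ => hconj g, Finset.sum_const,
    Finset.card_univ, Nat.cast_smul_eq_nsmul]

theorem Commutes.exists_hermAvg_eq {A : Matrix (Fin d) (Fin d) ℂ} (hA : ρ.Commutes A)
    (hH : A.IsHermitian) : ∃ Q, ρ.hermAvg Q = A := by
  have hherm : ρ.hermAvg A = (2 * Fintype.card G : ℝ) • A := by
    rw [hermAvg, hA.avg_eq, Matrix.conjTranspose_smul, hH.eq, star_trivial, ← add_smul, two_mul]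
  refine ⟨(2 * Fintype.card G : ℝ)⁻¹ • A, ?_⟩
  rw [ρ.isLinearMap_hermAvg.map_smul, hherm, inv_smul_smul₀ (by simp)]

theorem Invariant.exists_hermOp_eq {W : Submodule ℂ (Carrier d)} (hW : ρ.Invariant W) :
    ∃ R, ρ.hermOp R = W.starProjection.toLinearMap := by
  have hherm : (Matrix.toEuclideanLin.symm W.starProjection.toLinearMap).IsHermitian := by
    rw [← Matrix.isSymmetric_toEuclideanLin_iff, LinearEquiv.apply_symm_apply]
    exact W.starProjection_isSymmetric
  obtain ⟨R, hR⟩ := hW.commutes_starProjection.exists_hermAvg_eq hherm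
  exact ⟨R, by rw [hermOp, hR, LinearEquiv.apply_symm_apply]⟩

variable (ρ)

theorem hermOp_add_real_smul (Q R : Matrix (Fin d) (Fin d) ℂ) (c : ℝ) :
    ρ.hermOp (Q + c • R) = ρ.hermOp Q + (c : ℂ) • ρ.hermOp R := by
  rw [hermOp, ρ.isLinearMap_hermAvg.map_add, ρ.isLinearMap_hermAvg.map_smul,
    RCLike.real_smul_eq_coe_smul (K := ℂ), map_add, map_smul]
  rfl

theorem minpoly_hermOp (Q : Matrix (Fin d) (Fin d) ℂ) :
    minpoly ℂ (ρ.hermOp Q) = minpoly ℂ (ρ.hermAvg Q) :=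
  minpoly.algEquiv_eq (Matrix.toLpLinAlgEquiv 2) (ρ.hermAvg Q)

variable {ρ}

theorem isIrreducibleComponent_eigenspace {Q : Matrix (Fin d) (Fin d) ℂ}
    (hmax : ∀ R, (minpoly ℂ (ρ.hermOp R)).natDegree ≤ (minpoly ℂ (ρ.hermOp Q)).natDegree)
    (μ : (ρ.hermOp Q).Eigenvalues) :
    ρ.IsIrreducibleComponent ((ρ.hermOp Q).eigenspace μ) := by
  refine ⟨μ.2, ρ.invariant_eigenspace_hermOp Q μ, fun W hW hinv => ?_⟩
  by_contra! hne
  obtain ⟨ε, hε⟩ := exists_natDegree_minpoly_lt_add_smul_starProjection (ρ.isSymmetric_hermOp Q)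
    hne.1 (hW.lt_of_ne hne.2)
  obtain ⟨R, hR⟩ := hinv.exists_hermOp_eq
  rw [← hR, ← hermOp_add_real_smul] at hε
  exact (hmax (Q + ε • R)).not_gt hε

theorem eigenspacesReduce_of_forall_natDegree_minpoly_le {Q : Matrix (Fin d) (Fin d) ℂ}
    (hmax : ∀ R, (minpoly ℂ (ρ.hermOp R)).natDegree ≤ (minpoly ℂ (ρ.hermOp Q)).natDegree) :
    ρ.EigenspacesReduce Q where
  irreducible := isIrreducibleComponent_eigenspace hmax
  isInternal := (ρ.isSymmetric_hermOp Q).direct_sum_isInternal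
  orthogonal _ _ hμν := Submodule.IsOrtho.starProjection_comp_starProjection <|
    (ρ.isSymmetric_hermOp Q).orthogonalFamily_eigenspaces'.isOrtho hμν
  sum_eq_id := by
    ext1 v
    rw [_root_.sum_apply]
    refine (ρ.isSymmetric_hermOp Q).orthogonalFamily_eigenspaces'.sum_projection_of_mem_iSup v ?_
    rw [(ρ.isSymmetric_hermOp Q).direct_sum_isInternal.submodule_iSup_eq_top]
    exact Submodule.mem_top
  commute μ := (ρ.invariant_eigenspace_hermOp Q μ).starProjection_op

variable (ρ)

theorem ae_forall_natDegree_minpoly_hermOp_le :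
    ∀ᵐ Q : Fin d → Fin d → ℂ, ∀ R,
      (minpoly ℂ (ρ.hermOp R)).natDegree ≤ (minpoly ℂ (ρ.hermOp (Matrix.of Q))).natDegree := by
  have hrow : (volume : Measure (Fin d → ℂ)).IsAddHaarMeasure :=
    Measure.pi.isAddHaarMeasure fun _ => volume
  have hmat : (volume : Measure (Fin d → Fin d → ℂ)).IsAddHaarMeasure :=
    Measure.pi.isAddHaarMeasure fun _ => volume
  let L : (Fin d → Fin d → ℂ) →ₗ[ℝ] Matrix (Fin d) (Fin d) ℂ :=
    ρ.isLinearMap_hermAvg.mk' ρ.hermAvg ∘ₗ (Matrix.ofLinearEquiv ℝ).toLinearMap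
  simp only [minpoly_hermOp]
  exact ae_forall_natDegree_minpoly_le (𝕜 := ℂ) L.toContinuousLinearMap volume

theorem ae_eigenspacesReduce : ∀ᵐ Q : Fin d → Fin d → ℂ, ρ.EigenspacesReduce (Matrix.of Q) := by
  filter_upwards [ρ.ae_forall_natDegree_minpoly_hermOp_le] with Q hQ
  exact eigenspacesReduce_of_forall_natDegree_minpoly_le hQ

end Average

end Corep

end ProjCorep

theorem mainTheorem3 {G : Type*} [Group G] [Fintype G] (s : G →* ℤˣ)
    (ω : ProjCorep.FactorSystem s) (d : ℕ) (ρ : ProjCorep.Corep s ω d)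
    {Ω : Type*} [MeasurableSpace Ω] (P : Measure Ω) [IsProbabilityMeasure P]
    (Q₀ : Ω → Fin d → Fin d → ℂ) (hQ₀ : AEMeasurable Q₀ P)
    (hlaw : (P.map Q₀).AbsolutelyContinuous volume) :
    ∀ᵐ x ∂P, ρ.EigenspacesReduce (Matrix.of (Q₀ x)) :=
  ae_of_ae_map hQ₀ (hlaw.ae_le ρ.ae_eigenspacesReduce)
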